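/- Let $G$ be a finite simple graph on $n\ge 1$ vertices. Its Laplacian matrix $L(G)$ is the $n\times n$ matrix, with rows and columns indexed by the vertices, whose $(i,j)$ entry is $\deg(i)$ if $i=j$, $-1$ if $i\ne j$ and $\{i,j\}$ is an edge of $G$, and $0$ otherwise. A spanning tree of $G$ is a subgraph $T\subseteq G$ with $V(T)=V(G)$ that is connected and contains no cycle; let $\tau(G)$ denote the number of spanning trees of $G$. If $\lambda_1,\dots,\lambda_n$ are the eigenvalues of $L(G)$, listed with multiplicity, and $\lambda_n=0$, then $$\tau(G)=\frac{\lambda_1\cdots\lambda_{n-1}}{n}.$$ -/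

import Mathlib

/-- A subgraph `T` of `G` is a spanning tree of `G` if `V(T) = V(G)`, `T` is connected and `T`
contains no cycle. -/
def IsSpanningTree {V : Type*} {G : SimpleGraph V} (T : G.Subgraph) : Prop :=
  T.IsSpanning ∧ T.coe.Connected ∧ T.coe.IsAcyclic

/-- The number `τ(G)` of spanning trees of `G` (for a finite graph `G`). -/
noncomputable def numSpanningTrees {V : Type*} (G : SimpleGraph V) : ℕ :=
  {T : G.Subgraph | IsSpanningTree T}.ncard

/-- `lam` lists the eigenvalues of the real `V × V` matrix `A`, each repeated according to its
(algebraic) multiplicity as a root of the characteristic polynomial. -/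
def IsEigenvalueList {V : Type*} [Fintype V] [DecidableEq V] {n : ℕ}
    (A : Matrix V V ℝ) (lam : Fin n → ℝ) : Prop :=
  A.charpoly.roots = (Finset.univ : Finset (Fin n)).val.map lam

/-! The linear coefficient of the characteristic polynomial is, up to the same sign, both `λ₁⋯λₙ₋₁`
(as `λₙ = 0`) and the trace of the adjugate, so it suffices that each diagonal cofactor is `τ(G)`.
Replace row `r` of the Laplacian by `e_r`; every other row `i` is the sum of `e_i - e_j` over
neighbours `j`. Multilinearity turns the determinant into a sum over choices `f` of a neighbour for
each `i ≠ r`. A choice contributes 1 if its iterates lead every vertex to `r`, and 0 otherwise;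
those contributing 1 are the spanning trees oriented towards `r`. -/

theorem Matrix.derivative_det {V R : Type*} [Fintype V] [DecidableEq V] [CommRing R]
    (M : Matrix V V (Polynomial R)) :
    Polynomial.derivative M.det =
      ∑ r, (M.updateCol r fun i => Polynomial.derivative (M i r)).det := by
  simp only [Matrix.det_apply', Polynomial.derivative_sum]
  rw [Finset.sum_comm]
  refine Finset.sum_congr rfl fun σ _ => ?_
  rw [Polynomial.derivative_intCast_mul, Polynomial.derivative_prod_finset, Finset.mul_sum]
  refine Finset.sum_congr rfl fun r _ => ?_
  rw [← Finset.prod_erase_mul _ _ (Finset.mem_univ r), Matrix.updateCol_self]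
  congr 2
  exact Finset.prod_congr rfl fun i hi => by
    rw [Matrix.updateCol_ne (Finset.ne_of_mem_erase hi)]

/-- Differentiating column `r` of `X - A` gives `e_r`, so at `X = 0` each summand is a diagonal
cofactor of `-A`. -/
theorem Matrix.eval_zero_derivative_charpoly {V R : Type*} [Fintype V] [DecidableEq V]
    [CommRing R] (A : Matrix V V R) :
    (Polynomial.derivative A.charpoly).eval 0 =
      (-1) ^ (Fintype.card V - 1) * A.adjugate.trace := by
  have h : ((-1 : R) ^ (Fintype.card V - 1)) • A.adjugate = (-A).adjugate := by
    rw [← Matrix.adjugate_smul, neg_one_smul]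
  rw [← smul_eq_mul, ← Matrix.trace_smul, h, Matrix.charpoly, Matrix.derivative_det,
    Polynomial.eval_finsetSum]
  refine Finset.sum_congr rfl fun r _ => ?_
  rw [Matrix.diag_apply, ← Matrix.transpose_apply (-A).adjugate, Matrix.adjugate_transpose,
    Matrix.adjugate_apply, Matrix.updateRow_transpose, Matrix.det_transpose,
    ← Polynomial.coe_evalRingHom, RingHom.map_det]
  congr 1
  ext i j
  by_cases hj : j = r
  · subst hj
    by_cases hi : i = j
    · subst hi
      simp [Matrix.charmatrix_apply]
    · simp [Matrix.charmatrix_apply, hi]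
  · by_cases hi : i = j
    · subst hi
      simp [Matrix.charmatrix_apply, hj]
    · simp [Matrix.charmatrix_apply, hj, hi]

/-- `f` is a parent function rooted at `r`: it fixes `r` and iterating it leads every vertex
to `r`. -/
structure IsParentFunction {V : Type*} (r : V) (f : V → V) : Prop where
  map_root : f r = r
  exists_iterate_eq : ∀ i, ∃ k, f^[k] i = r

/-- The graph whose edges join each point to its image under `f`. -/
def functionalGraph {V : Type*} (f : V → V) : SimpleGraph V :=
  SimpleGraph.fromRel fun i j => f i = j

theorem functionalGraph_adj {V : Type*} {f : V → V} {i j : V} :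
    (functionalGraph f).Adj i j ↔ i ≠ j ∧ (f i = j ∨ f j = i) :=
  SimpleGraph.fromRel_adj _ _ _

theorem functionalGraph_le {V : Type*} {G : SimpleGraph V} {r : V} {f : V → V} (hr : f r = r)
    (hf : ∀ i, i ≠ r → G.Adj i (f i)) : functionalGraph f ≤ G := by
  intro i j h
  obtain ⟨hne, rfl | rfl⟩ := functionalGraph_adj.1 h
  · exact hf i fun h => hne (by rw [h, hr])
  · exact (hf j fun h => hne (by rw [h, hr])).symm

namespace IsParentFunction

variable {V : Type*} {r : V} {f g : V → V}

theorem apply_ne (h : IsParentFunction r f) {i : V} (hi : i ≠ r) : f i ≠ i := by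
  intro hfi
  obtain ⟨k, hk⟩ := h.exists_iterate_eq i
  rw [Function.iterate_fixed hfi] at hk
  exact hi hk

theorem apply_apply_ne (h : IsParentFunction r f) {i : V} (hi : i ≠ r) : f (f i) ≠ i := by
  intro hfi
  have key : ∀ k, f^[k] i = i ∨ f^[k] i = f i := by
    intro k
    induction k with
    | zero => exact Or.inl rfl
    | succ k ih =>
      rw [Function.iterate_succ_apply']
      rcases ih with ih | ih <;> simp [ih, hfi]
  obtain ⟨k, hk⟩ := h.exists_iterate_eq i
  rcases key k with h' | h'
  · exact hi (h'.symm.trans hk)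
  · have hfr : f i = r := h'.symm.trans hk
    exact hi (by rw [← hfi, hfr, h.map_root])

theorem adj (h : IsParentFunction r f) {i : V} (hi : i ≠ r) : (functionalGraph f).Adj i (f i) :=
  functionalGraph_adj.2 ⟨(h.apply_ne hi).symm, Or.inl rfl⟩

theorem connected (h : IsParentFunction r f) : (functionalGraph f).Connected := by
  have step : ∀ i, (functionalGraph f).Reachable i (f i) := fun i => by
    by_cases hi : i = r
    · rw [hi, h.map_root]
    · exact (h.adj hi).reachable
  have reach : ∀ k i, (functionalGraph f).Reachable i (f^[k] i) := by
    intro k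
    induction k with
    | zero => exact fun i => .refl i
    | succ k ih => exact fun i => (step i).trans (ih (f i))
  have root : ∀ i, (functionalGraph f).Reachable i r := fun i => by
    obtain ⟨k, hk⟩ := h.exists_iterate_eq i
    exact hk ▸ reach k i
  exact (SimpleGraph.connected_iff _).2 ⟨fun i j => (root i).trans (root j).symm, ⟨r⟩⟩

theorem isTree [Finite V] (h : IsParentFunction r f) : (functionalGraph f).IsTree := by
  refine SimpleGraph.isTree_iff_connected_and_card.2
    ⟨h.connected, le_antisymm ?_ h.connected.card_vert_le_card_edgeSet_add_one⟩
  -- Each non-root vertex accounts for at most one edge, which bounds the edge count by `|V| - 1`.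
  have hsub : (functionalGraph f).edgeSet ⊆ (fun i => s(i, f i)) '' {r}ᶜ := by
    intro e he
    induction e with
    | _ i j =>
      obtain ⟨hne, rfl | rfl⟩ : i ≠ j ∧ (f i = j ∨ f j = i) := functionalGraph_adj.1 he
      · exact ⟨i, fun hi => hne (by rw [Set.mem_singleton_iff.1 hi, h.map_root]), rfl⟩
      · exact ⟨j, fun hj => hne (by rw [Set.mem_singleton_iff.1 hj, h.map_root]), Sym2.eq_swap⟩
  have hle := (Set.ncard_le_ncard hsub (Set.toFinite _)).trans (Set.ncard_image_le (Set.toFinite _))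
  have hc := Set.ncard_add_ncard_compl ({r} : Set V)
  rw [Set.ncard_singleton] at hc
  rw [Nat.card_coe_set_eq]
  omega

theorem eq_of_functionalGraph_eq (hf : IsParentFunction r f) (hg : IsParentFunction r g)
    (h : functionalGraph f = functionalGraph g) : f = g := by
  funext i
  by_contra hne
  -- Disagreement propagates along `g` up to the root, where both functions agree.
  have step : ∀ j, f j ≠ g j → f (g j) ≠ g (g j) := by
    intro j hj
    have hjr : j ≠ r := fun hjr => hj (by rw [hjr, hf.map_root, hg.map_root])
    have hadj := hg.adj hjr
    rw [← h] at hadj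
    have hfg : f (g j) = j := (functionalGraph_adj.1 hadj).2.resolve_left hj
    rw [hfg]
    exact (hg.apply_apply_ne hjr).symm
  have key : ∀ k, f (g^[k] i) ≠ g (g^[k] i) := by
    intro k
    induction k with
    | zero => exact hne
    | succ k ih => rw [Function.iterate_succ_apply']; exact step _ ih
  obtain ⟨k, hk⟩ := hg.exists_iterate_eq i
  exact key k (by rw [hk, hf.map_root, hg.map_root])

theorem det_eq_one [Fintype V] [DecidableEq V] (h : IsParentFunction r f) :
    (Matrix.of fun i => if i = r then Pi.single r (1 : ℝ)
      else Pi.single i 1 - Pi.single (f i) 1).det = 1 := by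
  classical
  set M : Matrix V V ℝ := Matrix.of fun i => if i = r then Pi.single r (1 : ℝ)
      else Pi.single i 1 - Pi.single (f i) 1 with hM
  -- The depth of `i`; ordering by depth makes the matrix unitriangular.
  let d : V → ℕ := fun i => Nat.find (h.exists_iterate_eq i)
  have hd : ∀ i, i ≠ r → d (f i) < d i := by
    intro i hi
    have hs : f^[d i] i = r := Nat.find_spec (h.exists_iterate_eq i)
    obtain ⟨k, hk⟩ : ∃ k, d i = k + 1 := Nat.exists_eq_succ_of_ne_zero fun h0 => hi (by
      rw [h0] at hs; exact hs)
    rw [hk, Function.iterate_succ_apply] at hs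
    have : d (f i) ≤ k := Nat.find_min' (h.exists_iterate_eq (f i)) hs
    omega
  have hentry : ∀ i j, i ≠ j → d i ≤ d j → M i j = 0 := by
    intro i j hij hle
    by_cases hi : i = r
    · subst hi
      simp [hM, hij.symm]
    · have hfj : j ≠ f i := fun hj => absurd (hd i hi) (by rw [← hj]; omega)
      simp [hM, hi, hij.symm, hfj]
  have hdiag : ∀ i, M i i = 1 := by
    intro i
    by_cases hi : i = r
    · subst hi
      simp [hM]
    · simp [hM, hi, (h.apply_ne hi).symm]
  have htri : M.transpose.BlockTriangular d := fun i j hij =>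
    hentry j i (fun e => by simp [e] at hij) hij.le
  rw [← Matrix.det_transpose, htri.det]
  refine Finset.prod_eq_one fun a _ => ?_
  convert Matrix.det_one (n := {i // d i = a}) (R := ℝ)
  ext i j
  by_cases hij : i = j
  · subst hij
    simp [Matrix.toSquareBlock_def, hdiag]
  · have : (j : V) ≠ i := fun e => hij (Subtype.ext e.symm)
    simp [Matrix.toSquareBlock_def, hentry _ _ this (by rw [i.2, j.2]), hij]

end IsParentFunction

theorem det_eq_zero_of_not_isParentFunction {V : Type*} [Fintype V] [DecidableEq V] {r : V}
    {f : V → V} (hr : f r = r) (h : ¬ IsParentFunction r f) :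
    (Matrix.of fun i => if i = r then Pi.single r (1 : ℝ)
      else Pi.single i 1 - Pi.single (f i) 1).det = 0 := by
  classical
  obtain ⟨i₀, hi₀⟩ : ∃ i, ¬ ∃ k, f^[k] i = r := by
    by_contra! hall
    exact h ⟨hr, hall⟩
  have hiff : ∀ i, (∃ k, f^[k] (f i) = r) ↔ ∃ k, f^[k] i = r := by
    refine fun i => ⟨fun ⟨k, hk⟩ => ⟨k + 1, hk⟩, fun ⟨k, hk⟩ => ⟨k, ?_⟩⟩
    rw [← Function.iterate_succ_apply, Function.iterate_succ_apply', hk, hr]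
  -- The indicator of the vertices that never reach `r` is a nonzero kernel vector.
  refine Matrix.exists_mulVec_eq_zero_iff.1
    ⟨fun i => if ∃ k, f^[k] i = r then 0 else 1, fun h0 => ?_, ?_⟩
  · simpa [hi₀] using congrFun h0 i₀
  · funext i
    rw [Matrix.mulVec]
    by_cases hi : i = r
    · subst hi
      have : ∃ k, f^[k] i = i := ⟨0, rfl⟩
      simp [this]
    · have hrow : (fun j => (Matrix.of fun i => if i = r then Pi.single r (1 : ℝ)
          else Pi.single i 1 - Pi.single (f i) 1) i j) = Pi.single i 1 - Pi.single (f i) 1 := by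
        exact if_neg hi
      rw [hrow, sub_dotProduct, single_one_dotProduct, single_one_dotProduct]
      simp [hiff]

theorem SimpleGraph.IsTree.exists_isParentFunction {V : Type*} {H : SimpleGraph V}
    (hH : H.IsTree) (r : V) :
    ∃ f, IsParentFunction r f ∧ functionalGraph f = H := by
  -- The parent is the next vertex on a shortest walk to `r`.
  have hstep : ∀ i, ∃ j, i ≠ r → H.Adj i j ∧ H.dist j r < H.dist i r := by
    intro i
    by_cases hi : i = r
    · exact ⟨i, fun h => absurd hi h⟩
    obtain ⟨p, hp⟩ := hH.connected.exists_walk_length_eq_dist i r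
    cases p with
    | nil => exact absurd rfl hi
    | @cons _ j _ hadj q =>
      refine ⟨j, fun _ => ⟨hadj, ?_⟩⟩
      have := SimpleGraph.dist_le q
      rw [SimpleGraph.Walk.length_cons] at hp
      omega
  classical
  choose g hg using hstep
  let f : V → V := fun i => if i = r then r else g i
  have hfr : f r = r := if_pos rfl
  have hf : ∀ i, i ≠ r → H.Adj i (f i) ∧ H.dist (f i) r < H.dist i r := fun i hi => by
    simpa only [f, if_neg hi] using hg i hi
  have hpf : IsParentFunction r f := by
    refine ⟨hfr, fun i => ?_⟩
    induction hn : H.dist i r using Nat.strong_induction_on generalizing i with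
    | _ n ih =>
      by_cases hi : i = r
      · exact ⟨0, hi⟩
      · obtain ⟨k, hk⟩ := ih _ (hn ▸ (hf i hi).2) (f i) rfl
        exact ⟨k + 1, hk⟩
  refine ⟨f, hpf, ?_⟩
  have hle : functionalGraph f ≤ H := functionalGraph_le hfr fun i hi => (hf i hi).1
  exact le_antisymm hle
    ((SimpleGraph.isTree_iff_minimal_connected.1 hH).le_of_le hpf.connected hle)

theorem numSpanningTrees_eq_ncard_isTree {V : Type*} (G : SimpleGraph V) :
    numSpanningTrees G = {H : SimpleGraph V | H ≤ G ∧ H.IsTree}.ncard := by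
  refine Set.ncard_congr (fun T _ => T.spanningCoe) ?_ ?_ ?_
  · rintro T ⟨hs, hc, ha⟩
    exact ⟨T.spanningCoe_le,
      (T.spanningCoeEquivCoeOfSpanning hs).isTree_iff.2 ⟨hc, ha⟩⟩
  · rintro T T' ⟨hs, -⟩ ⟨hs', -⟩ h
    exact SimpleGraph.Subgraph.ext
      ((SimpleGraph.Subgraph.isSpanning_iff.1 hs).trans
        (SimpleGraph.Subgraph.isSpanning_iff.1 hs').symm)
      (SimpleGraph.Subgraph.spanningCoe_inj.1 h)
  · rintro H ⟨hle, hH⟩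
    have hs := SimpleGraph.toSubgraph.isSpanning H hle
    have ht := ((SimpleGraph.toSubgraph H hle).spanningCoeEquivCoeOfSpanning hs).isTree_iff.1 hH
    exact ⟨SimpleGraph.toSubgraph H hle, ⟨hs, ht.connected, ht.isAcyclic⟩, rfl⟩

theorem numSpanningTrees_eq_ncard_isParentFunction {V : Type*} [Finite V] (G : SimpleGraph V)
    (r : V) :
    numSpanningTrees G =
      {f : V → V | IsParentFunction r f ∧ ∀ i, i ≠ r → G.Adj i (f i)}.ncard := by
  rw [numSpanningTrees_eq_ncard_isTree]
  symm
  refine Set.ncard_congr (fun f _ => functionalGraph f) ?_ ?_ ?_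
  · rintro f ⟨hf, hG⟩
    exact ⟨functionalGraph_le hf.map_root hG, hf.isTree⟩
  · rintro f g ⟨hf, -⟩ ⟨hg, -⟩ h
    exact hf.eq_of_functionalGraph_eq hg h
  · rintro H ⟨hle, hH⟩
    obtain ⟨f, hf, rfl⟩ := hH.exists_isParentFunction r
    exact ⟨f, ⟨hf, fun i hi => hle (hf.adj hi)⟩, rfl⟩

/-- **Kirchhoff's theorem**: every principal cofactor of the Laplacian counts spanning trees. -/
theorem adjugate_lapMatrix_apply_self {V : Type*} [Fintype V] [DecidableEq V]
    (G : SimpleGraph V) [DecidableRel G.Adj] (r : V) :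
    (G.lapMatrix ℝ).adjugate r r = numSpanningTrees G := by
  classical
  -- The singleton at `r` forces every choice function to fix the root.
  let s : V → Finset V := fun i => if i = r then {r} else G.neighborFinset i
  let g : V → V → V → ℝ := fun i j =>
    if i = r then Pi.single r 1 else Pi.single i 1 - Pi.single j 1
  have hrows : (G.lapMatrix ℝ).updateRow r (Pi.single r 1) = fun i => ∑ j ∈ s i, g i j := by
    funext i
    by_cases hi : i = r
    · subst hi
      rw [Matrix.updateRow_self]
      simp [s, g]
    · rw [Matrix.updateRow_ne hi]
      funext k
      simp only [s, g, if_neg hi, Finset.sum_sub_distrib, Finset.sum_apply, Pi.sub_apply,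
        Finset.sum_const, SimpleGraph.card_neighborFinset_eq_degree, SimpleGraph.lapMatrix,
        Matrix.sub_apply, SimpleGraph.degMatrix, SimpleGraph.adjMatrix_apply]
      congr 1
      · simp [Matrix.diagonal_apply, Pi.single_apply, eq_comm]
      · simp [Pi.single_apply]
  rw [Matrix.adjugate_apply, hrows]
  change (Matrix.detRowAlternating (R := ℝ) (n := V)).toMultilinearMap
    (fun i => ∑ j ∈ s i, g i j) = _
  rw [MultilinearMap.map_sum_finset]
  have hterm : ∀ f ∈ Fintype.piFinset s,
      (Matrix.detRowAlternating (R := ℝ) (n := V)).toMultilinearMap (fun i => g i (f i)) =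
        if IsParentFunction r f then 1 else 0 := by
    intro f hf
    have hr : f r = r := by simpa [s] using Fintype.mem_piFinset.1 hf r
    split_ifs with h
    · exact h.det_eq_one
    · exact det_eq_zero_of_not_isParentFunction hr h
  rw [Finset.sum_congr rfl hterm, Finset.sum_boole, numSpanningTrees_eq_ncard_isParentFunction G r,
    ← Set.ncard_coe_finset]
  congr 2
  ext f
  simp only [Finset.coe_filter, Fintype.mem_piFinset, Set.mem_ofPred_eq]
  constructor
  · rintro ⟨hs, hf⟩
    exact ⟨hf, fun i hi => by simpa [s, hi] using hs i⟩
  · rintro ⟨hf, hG⟩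
    refine ⟨fun i => ?_, hf⟩
    by_cases hi : i = r
    · simp [s, hi, hf.map_root]
    · simpa [s, hi] using hG i hi

theorem IsEigenvalueList.charpoly_eq_prod {V : Type*} [Fintype V] [DecidableEq V] {n : ℕ}
    {A : Matrix V V ℝ} {lam : Fin n → ℝ} (h : IsEigenvalueList A lam)
    (hV : Fintype.card V = n) :
    A.charpoly = ∏ i, (Polynomial.X - Polynomial.C (lam i)) := by
  have hroots : A.charpoly.roots = (Finset.univ : Finset (Fin n)).val.map lam := h
  rw [← Polynomial.prod_multiset_X_sub_C_of_monic_of_roots_card_eq A.charpoly_monic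
    (by rw [hroots, Matrix.charpoly_natDegree_eq_dim, hV]; simp), hroots, Multiset.map_map]
  rfl

theorem mainTheorem2 {V : Type*} [Fintype V] [DecidableEq V]
    (G : SimpleGraph V) [DecidableRel G.Adj]
    (n : ℕ) (hn : 0 < n) (hV : Fintype.card V = n)
    (lam : Fin n → ℝ) (hlam : IsEigenvalueList (G.lapMatrix ℝ) lam)
    (h0 : lam ⟨n - 1, Nat.sub_one_lt_of_lt hn⟩ = 0) :
    (numSpanningTrees G : ℝ) =
      (∏ i : Fin (n - 1), lam (Fin.castLE (Nat.sub_le n 1) i)) / (n : ℝ) := by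
  obtain ⟨m, rfl⟩ := Nat.exists_eq_succ_of_ne_zero hn.ne'
  have hder := Matrix.eval_zero_derivative_charpoly (G.lapMatrix ℝ)
  have htrace : (G.lapMatrix ℝ).adjugate.trace = (m + 1 : ℕ) * (numSpanningTrees G : ℝ) := by
    simp [Matrix.trace, adjugate_lapMatrix_apply_self, hV]
  have hlast : lam (Fin.last m) = 0 := h0
  rw [hlam.charpoly_eq_prod hV, Fin.prod_univ_castSucc, hlast, htrace, hV] at hder
  simp only [Polynomial.C_0, sub_zero, Polynomial.derivative_mul, Polynomial.derivative_X,
    mul_one, Polynomial.eval_add, Polynomial.eval_mul, Polynomial.eval_X, mul_zero, zero_add,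
    Polynomial.eval_prod, Polynomial.eval_sub, Polynomial.eval_C, zero_sub, Finset.prod_neg,
    Finset.card_univ, Fintype.card_fin] at hder
  have hprod := mul_left_cancel₀ (pow_ne_zero m (by norm_num : (-1 : ℝ) ≠ 0)) hder
  rw [eq_div_iff (by positivity), mul_comm]
  exact hprod.symm
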